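/- Let $p$ be a prime number, $k$ a commutative ring of characteristic $p$ and $A$ a commutative $k$-algebra. For an integer $m\ge 1$, a Hasse–Schmidt derivation of $A$ over $k$ of length $m$ is a sequence $(D_0,D_1,\dots,D_m)$ of $k$-linear maps $D_i:A\to A$ with $D_0=\mathrm{Id}_A$ and $D_i(xy)=\sum_{a+b=i}D_a(x)D_b(y)$ for all $x,y\in A$ and $0\le i\le m$. Let $\mathrm{IDer}_k(A;m)$ be the $A$-submodule of $\mathrm{Der}_k(A)$ consisting of the derivations $\delta$ for which there is a Hasse–Schmidt derivation $(D_0,\dots,D_m)$ of $A$ over $k$ of length $m$ with $D_1=\delta$. One says that $A$ has a leap at an integer $s>1$ if the inclusion $\mathrm{IDer}_k(A;s)\subseteq\mathrm{IDer}_k(A;s-1)$ is proper. **Theorem 4.1.** For every integer $n>1$ that is not a power of $p$, $\mathrm{IDer}_k(A;n-1)=\mathrm{IDer}_k(A;n)$. In other words, if $A$ has a leap at $s>1$, then $s$ is a power of $p$. -/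

import Mathlib

universe u v

/-- A Hasse–Schmidt derivation of `A` over `k` of length `m ∈ ℕ ∪ {∞}`: a sequence of `k`-linear
maps `D_0, D_1, …` of `A`, indexed by the `n ≤ m`, with `D_0 = Id` and
`D_n (x y) = ∑_{i + j = n} D_i x * D_j y`. The sequence `comp` is indexed by all of `ℕ`; its
entries beyond the length are set to zero, so that two Hasse–Schmidt derivations of length `m` are
equal exactly when their components of index `≤ m` are. -/
@[ext]
structure HasseSchmidt (k : Type u) (A : Type v) [CommRing k] [CommRing A] [Algebra k A]
    (m : ℕ∞) where
  /-- the components `D_n` -/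
  comp : ℕ → A →ₗ[k] A
  comp_zero : comp 0 = LinearMap.id
  leibniz : ∀ n : ℕ, (n : ℕ∞) ≤ m → ∀ x y : A,
    comp n (x * y) = ∑ ij ∈ Finset.HasAntidiagonal.antidiagonal n, comp ij.1 x * comp ij.2 y
  comp_eq_zero : ∀ n : ℕ, m < (n : ℕ∞) → comp n = 0

namespace HasseSchmidt

open Finset

variable {k : Type u} {A : Type v} [CommRing k] [CommRing A] [Algebra k A] {m : ℕ∞}

/-- The identity `(Id, 0, 0, …)`. -/
def one : HasseSchmidt k A m where
  comp n := if n = 0 then LinearMap.id else 0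
  comp_zero := by simp
  leibniz n _ x y := by
    rcases Nat.eq_zero_or_pos n with rfl | hn
    · simp
    · rw [if_neg hn.ne', LinearMap.zero_apply]
      refine (Finset.sum_eq_zero fun ij hij => ?_).symm
      rw [HasAntidiagonal.mem_antidiagonal] at hij
      by_cases h1 : ij.1 = 0
      · have h2 : ij.2 ≠ 0 := by omega
        simp [h2]
      · simp [h1]
  comp_eq_zero n hn := by
    have : n ≠ 0 := by rintro rfl; simp at hn
    simp [this]

/-- The composition `D ∘ E`, with components `∑_{i + j = n} D_i ∘ E_j` for `n ≤ m`. -/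
noncomputable def mul (D E : HasseSchmidt k A m) : HasseSchmidt k A m where
  comp n := open Classical in
    if (n : ℕ∞) ≤ m then ∑ ij ∈ antidiagonal n, D.comp ij.1 ∘ₗ E.comp ij.2 else 0
  comp_zero := by simp [D.comp_zero, E.comp_zero]
  leibniz n hn x y := by
    have key : ∀ i : ℕ, i ≤ n → (i : ℕ∞) ≤ m := fun i hi =>
      le_trans (by exact_mod_cast hi) hn
    have hL : (∑ ij ∈ antidiagonal n, D.comp ij.1 ∘ₗ E.comp ij.2) (x * y) =
        ∑ ij ∈ antidiagonal n, ∑ ab ∈ antidiagonal ij.2, ∑ cd ∈ antidiagonal ij.1,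
          D.comp cd.1 (E.comp ab.1 x) * D.comp cd.2 (E.comp ab.2 y) := by
      rw [LinearMap.sum_apply]
      refine sum_congr rfl fun ij hij => ?_
      rw [HasAntidiagonal.mem_antidiagonal] at hij
      rw [LinearMap.comp_apply, E.leibniz _ (key _ (by omega)), map_sum]
      exact sum_congr rfl fun ab _ => D.leibniz _ (key _ (by omega)) _ _
    have hR : ∀ uv ∈ antidiagonal n,
        ((if ((uv.1 : ℕ) : ℕ∞) ≤ m then
            ∑ ij ∈ antidiagonal uv.1, D.comp ij.1 ∘ₗ E.comp ij.2 else 0) x) *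
          ((if ((uv.2 : ℕ) : ℕ∞) ≤ m then
            ∑ ij ∈ antidiagonal uv.2, D.comp ij.1 ∘ₗ E.comp ij.2 else 0) y) =
        ∑ ca ∈ antidiagonal uv.1, ∑ db ∈ antidiagonal uv.2,
          D.comp ca.1 (E.comp ca.2 x) * D.comp db.1 (E.comp db.2 y) := by
      intro uv huv
      rw [HasAntidiagonal.mem_antidiagonal] at huv
      rw [if_pos (key _ (by omega)), if_pos (key _ (by omega)), LinearMap.sum_apply,
        LinearMap.sum_apply, sum_mul_sum]
      rfl
    rw [if_pos hn, hL, sum_congr rfl hR]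
    simp only [sum_sigma']
    refine sum_bij'
      (fun s _ => ⟨(s.2.2.1 + s.2.1.1, s.2.2.2 + s.2.1.2),
        ⟨(s.2.2.1, s.2.1.1), (s.2.2.2, s.2.1.2)⟩⟩)
      (fun s _ => ⟨(s.2.1.1 + s.2.2.1, s.2.1.2 + s.2.2.2),
        ⟨(s.2.1.2, s.2.2.2), (s.2.1.1, s.2.2.1)⟩⟩) ?_ ?_ ?_ ?_ ?_
    all_goals
      rintro ⟨⟨i, j⟩, ⟨a, b⟩, ⟨c, d⟩⟩ h
      simp only [mem_sigma, HasAntidiagonal.mem_antidiagonal] at h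
      obtain ⟨h1, h2, h3⟩ := h
      subst h2 h3
      first
      | rfl
      | simp only [mem_sigma, HasAntidiagonal.mem_antidiagonal, and_true]
        omega
  comp_eq_zero n hn := if_neg (not_le.mpr hn)

/-- The operation `a • D = (a ^ n D_n)_n`. -/
def smul (a : A) (D : HasseSchmidt k A m) : HasseSchmidt k A m where
  comp n := a ^ n • D.comp n
  comp_zero := by simp [D.comp_zero]
  leibniz n hn x y := by
    rw [LinearMap.smul_apply, D.leibniz n hn, smul_sum]
    refine sum_congr rfl fun ij hij => ?_
    rw [← HasAntidiagonal.mem_antidiagonal.mp hij]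
    simp only [LinearMap.smul_apply, smul_eq_mul]
    ring
  comp_eq_zero n hn := by rw [D.comp_eq_zero n hn, smul_zero]

theorem mul_comp_one (D E : HasseSchmidt k A m) :
    (mul D E).comp 1 = D.comp 1 + E.comp 1 := by
  by_cases h : ((1 : ℕ) : ℕ∞) ≤ m
  · have : (mul D E).comp 1 = ∑ ij ∈ antidiagonal 1, D.comp ij.1 ∘ₗ E.comp ij.2 := if_pos h
    rw [this, Nat.antidiagonal_succ]
    simp [D.comp_zero, E.comp_zero, add_comm]
  · rw [not_le] at h
    rw [comp_eq_zero _ 1 h, comp_eq_zero _ 1 h, comp_eq_zero _ 1 h, add_zero]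

end HasseSchmidt

/-- `IDer_k(A; m)`, the `A`-module of the `m`-integrable `k`-derivations of `A`: the derivations
that are the component of index `1` of a Hasse–Schmidt derivation of length `m` (meaningful for
`1 ≤ m`). -/
def IDer (k : Type u) (A : Type v) [CommRing k] [CommRing A] [Algebra k A] (m : ℕ∞) :
    Submodule A (Derivation k A A) where
  carrier := {δ | ∃ D : HasseSchmidt k A m, D.comp 1 = (δ : A →ₗ[k] A)}
  zero_mem' := ⟨HasseSchmidt.one, rfl⟩
  add_mem' := by
    rintro δ ε ⟨D, hD⟩ ⟨E, hE⟩
    exact ⟨D.mul E, by rw [HasseSchmidt.mul_comp_one, hD, hE]; rfl⟩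
  smul_mem' := by
    rintro a δ ⟨D, hD⟩
    refine ⟨D.smul a, ?_⟩
    change a ^ 1 • D.comp 1 = _
    rw [hD, pow_one]
    rfl

/-- `A` has a leap at `s > 1` if the inclusion `IDer_k(A; s) ⊆ IDer_k(A; s - 1)` is proper. -/
def HasLeap (k : Type u) (A : Type v) [CommRing k] [CommRing A] [Algebra k A] (s : ℕ) : Prop :=
  1 < s ∧ IDer k A (s : ℕ∞) < IDer k A ((s - 1 : ℕ) : ℕ∞)

/-!
Read a Hasse–Schmidt derivation as a series `D(t) = ∑ D i t ^ i` over the noncommutative ring of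
`k`-linear endomorphisms of `A`. A series of length `n - 1` satisfies the Leibniz rule in degrees
below `n`; extended by any linear map in degree `n`, it has a defect there (`leibnizDefect`), and
the first defect is additive under products of series (`leibnizDefect_conv_of_lt`). It is therefore
enough to find a series in degrees at least `2` whose defect in degree `n` is opposite to that of
`D`: multiplying `D` by it gives a Hasse–Schmidt derivation of length `n` with the same component
of index `1`.

Write `n = m * q` with `m = p ^ s` and `q > 1` prime to `p`. The two-variable series `D(u + v)` has
the defect of `D`, multiplied by `n.choose m`, at the monomial `u ^ m * v ^ (m * (q - 1))`
(`leibnizDefect_add_variables`), and `n.choose m` is congruent to `q` modulo `p`, so invertible. If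
the support of a series lies in a cone, its part on an extreme ray is again a series with the
Leibniz rule, in the single variable given by the ray; dividing by this part removes the ray and
leaves the defects off the ray unchanged (`exists_remove_edge`). Removing in this way all rays of
slope less than `q - 1` makes the ray through `(1, q - 1)` extreme (`exists_cone_support`). The part
on this ray is a series `G` in one variable `w = u * v ^ (q - 1)` whose first defect is in degree
`m` and equals `n.choose m` times that of `D` (`exists_leibnizDefect_eq_choose_smul`). For a
suitable power `H` of `G`, the series `H(t ^ q)` has defect opposite to that of `D` in degree
`m * q = n`, and since `q > 1` it has no term of degree `1`.
-/

open Finset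

/-! ### The defect of the Leibniz rule and convolution -/

section Defect

variable {k A M : Type*} [CommRing k] [CommRing A] [Algebra k A] [AddCommMonoid M]
  [HasAntidiagonal M]

/-- The failure of the Leibniz rule in degree `a` of a family `f` of endomorphisms, read as the
formal series `∑ f b u ^ b` with coefficients in the noncommutative ring `Module.End k A`. It is
kept as a bare function of `x` and `y`; only its additive structure is used. -/
def leibnizDefect (f : M → Module.End k A) (a : M) (x y : A) : A :=
  f a (x * y) - ∑ bc ∈ antidiagonal a, f bc.1 x * f bc.2 y

/-- The identity `(f g)(x y) - (f g)(x) (f g)(y) =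
f (g (x y) - g x * g y) + (f (g x * g y) - f (g x) * f (g y))`, compared in degree `a`. -/
theorem leibnizDefect_conv (f g h : M → Module.End k A)
    (hh : ∀ a, h a = ∑ bc ∈ antidiagonal a, f bc.1 * g bc.2) (a : M) (x y : A) :
    leibnizDefect h a x y =
      ∑ bc ∈ antidiagonal a, f bc.1 (leibnizDefect g bc.2 x y) +
      ∑ bc ∈ antidiagonal a, ∑ de ∈ antidiagonal bc.2,
        leibnizDefect f bc.1 (g de.1 x) (g de.2 y) := by
  have hR : ∑ uv ∈ antidiagonal a, h uv.1 x * h uv.2 y =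
      ∑ bc ∈ antidiagonal a, ∑ de ∈ antidiagonal bc.2, ∑ uv ∈ antidiagonal bc.1,
        f uv.1 (g de.1 x) * f uv.2 (g de.2 y) := by
    simp only [hh, LinearMap.sum_apply, sum_mul_sum, Module.End.mul_apply, sum_sigma']
    refine sum_bij'
      (fun s _ => ⟨(s.2.1.1 + s.2.2.1, s.2.1.2 + s.2.2.2),
        ⟨(s.2.1.2, s.2.2.2), (s.2.1.1, s.2.2.1)⟩⟩)
      (fun s _ => ⟨(s.2.2.1 + s.2.1.1, s.2.2.2 + s.2.1.2),
        ⟨(s.2.2.1, s.2.1.1), (s.2.2.2, s.2.1.2)⟩⟩) ?_ ?_ ?_ ?_ ?_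
    all_goals
      rintro ⟨⟨i, j⟩, ⟨a, b⟩, ⟨c, d⟩⟩ h
      simp only [mem_sigma, HasAntidiagonal.mem_antidiagonal] at h
      obtain ⟨h1, h2, h3⟩ := h
      subst h2 h3
      first
      | rfl
      | simp only [mem_sigma, HasAntidiagonal.mem_antidiagonal, and_true]
        rw [← h1]
        exact add_add_add_comm _ _ _ _
  unfold leibnizDefect
  rw [hR, hh]
  simp only [map_sub, map_sum, sum_sub_distrib, LinearMap.sum_apply, Module.End.mul_apply]
  abel

variable [PartialOrder M] [CanonicallyOrderedAdd M] [IsOrderedCancelAddMonoid M]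

/-- In the first degree where the Leibniz rule may fail, the defect is additive under the product of
series. -/
theorem leibnizDefect_conv_of_lt (f g h : M → Module.End k A)
    (hh : ∀ a, h a = ∑ bc ∈ antidiagonal a, f bc.1 * g bc.2) (hf0 : f 0 = 1) (hg0 : g 0 = 1)
    (a : M) (hf : ∀ b < a, leibnizDefect f b = 0) (hg : ∀ b < a, leibnizDefect g b = 0) :
    leibnizDefect h a = leibnizDefect f a + leibnizDefect g a := by
  classical
  funext x y
  have lt1 : ∀ b c : M, b + c = a → c ≠ 0 → b < a := by
    rintro b c rfl hc
    exact lt_add_of_pos_right b (pos_iff_ne_zero.mpr hc)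
  rw [leibnizDefect_conv f g h hh, add_comm]
  simp only [Pi.add_apply]
  congr 1
  · rw [sum_eq_single (a, 0)]
    · rw [sum_eq_single (0, 0)]
      · simp [hg0]
      · rintro ⟨d, e⟩ hde hne
        rw [HasAntidiagonal.mem_antidiagonal, add_eq_zero] at hde
        simp_all
      · simp
    · rintro ⟨b, c⟩ hbc hne
      rw [HasAntidiagonal.mem_antidiagonal] at hbc
      have hc : c ≠ 0 := by rintro rfl; simp_all
      simp [hf b (lt1 b c hbc hc)]
    · simp
  · rw [sum_eq_single (0, a)]
    · simp [hf0]
    · rintro ⟨b, c⟩ hbc hne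
      rw [HasAntidiagonal.mem_antidiagonal] at hbc
      have hb : b ≠ 0 := by rintro rfl; simp_all
      simp [hg c (lt1 c b (by rw [add_comm]; exact hbc) hb)]
    · simp

end Defect

/-! ### Splitting off an edge of the support -/

section Edge

variable {k A σ : Type*} [CommRing k] [CommRing A] [Algebra k A] [DecidableEq σ]

/-- Let the support of `f` lie in the half-space `0 ≤ l`, and let `r` be the part of `f` on the edge
`l = 0`. Two indices of the half-space whose sum is on the edge are both on the edge, so `r` has
the defect of `f` there. Off the edge, all terms of the Leibniz rule for `r` vanish. -/
theorem leibnizDefect_edge (l : (σ →₀ ℕ) →+ ℤ) (f r : (σ →₀ ℕ) → Module.End k A)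
    (hr : ∀ b, r b = if l b = 0 then f b else 0) (a : σ →₀ ℕ)
    (hf : ∀ b ≤ a, f b ≠ 0 → 0 ≤ l b) :
    leibnizDefect r a = if l a = 0 then leibnizDefect f a else 0 := by
  funext x y
  split_ifs with ha
  · unfold leibnizDefect
    rw [hr, if_pos ha]
    congr 1
    refine sum_congr rfl fun ⟨b, c⟩ hbc => ?_
    rw [HasAntidiagonal.mem_antidiagonal] at hbc
    simp only at hbc ⊢
    have hl : l b + l c = 0 := by rw [← map_add, hbc, ha]
    by_cases hb : f b = 0
    · simp [hr, hb]
    by_cases hc : f c = 0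
    · simp [hr, hc]
    have h1 := hf b (hbc ▸ le_self_add) hb
    have h2 := hf c (hbc ▸ le_add_self) hc
    rw [hr, hr, if_pos (by omega), if_pos (by omega)]
  · unfold leibnizDefect
    rw [hr, if_neg ha, sum_eq_zero]
    · simp
    rintro ⟨b, c⟩ hbc
    rw [HasAntidiagonal.mem_antidiagonal] at hbc
    simp only at hbc ⊢
    have hl : l b + l c ≠ 0 := by rw [← map_add, hbc]; exact ha
    by_cases hb : l b = 0
    · rw [hr c, if_neg (by omega)]; simp
    · rw [hr b, if_neg hb]; simp

/-- Dividing a series with support in `0 ≤ l` by its part on the edge `l = 0` moves the support,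
apart from the index `0`, into `0 < l`. The defect at an index `a` off the edge is unchanged. -/
theorem exists_remove_edge (l : (σ →₀ ℕ) →+ ℤ) (f : (σ →₀ ℕ) → Module.End k A) (hf0 : f 0 = 1)
    (a : σ →₀ ℕ) (hfd : ∀ b < a, leibnizDefect f b = 0)
    (hf : ∀ b ≤ a, f b ≠ 0 → 0 ≤ l b) (hla : l a ≠ 0) :
    ∃ g : (σ →₀ ℕ) → Module.End k A, g 0 = 1 ∧ (∀ b < a, leibnizDefect g b = 0) ∧
      leibnizDefect g a = leibnizDefect f a ∧ ∀ b ≤ a, b ≠ 0 → g b ≠ 0 → 0 < l b := by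
  let r : MvPowerSeries σ (Module.End k A) := fun b => if l b = 0 then f b else 0
  let F : MvPowerSeries σ (Module.End k A) := f
  have hrc : ∀ b, MvPowerSeries.coeff b r = if l b = 0 then f b else 0 := fun _ => rfl
  have hFc : ∀ b, MvPowerSeries.coeff b F = f b := fun _ => rfl
  have hr0 : MvPowerSeries.constantCoeff r = ((1 : (Module.End k A)ˣ) : Module.End k A) := by
    rw [← MvPowerSeries.coeff_zero_eq_constantCoeff_apply, hrc, map_zero, if_pos rfl, hf0]; rfl
  -- `r` is invertible, being `1` in degree `0`; no support condition on `r⁻¹` is needed, since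
  -- everything below is read off from `G * r = F`.
  let G : MvPowerSeries σ (Module.End k A) := F * MvPowerSeries.invOfUnit r 1
  have hGr : G * r = F := by
    rw [mul_assoc, MvPowerSeries.invOfUnit_mul r 1 hr0, mul_one]
  have hconv : ∀ b, f b = ∑ cd ∈ antidiagonal b,
      MvPowerSeries.coeff cd.1 G * MvPowerSeries.coeff cd.2 r := by
    intro b
    rw [← MvPowerSeries.coeff_mul, hGr, hFc]
  have hrz : MvPowerSeries.coeff 0 r = 1 := by rw [hrc, map_zero, if_pos rfl, hf0]
  have hG0 : MvPowerSeries.coeff 0 G = 1 := by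
    have := hconv 0
    simpa [hf0, hrz] using this.symm
  have hrd : ∀ b ≤ a, leibnizDefect (fun b => MvPowerSeries.coeff b r) b =
      if l b = 0 then leibnizDefect f b else 0 := fun b hb =>
    leibnizDefect_edge l f _ hrc b fun c hc => hf c (hc.trans hb)
  have hrd0 : ∀ b < a, leibnizDefect (fun b => MvPowerSeries.coeff b r) b = 0 := fun b hb => by
    rw [hrd b hb.le, hfd b hb, ite_self]
  have hGd : ∀ b < a, leibnizDefect (fun b => MvPowerSeries.coeff b G) b = 0 := by
    intro b
    induction b using WellFoundedLT.induction with
    | ind b ih =>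
      intro hb
      have := leibnizDefect_conv_of_lt (fun b => MvPowerSeries.coeff b G)
        (fun b => MvPowerSeries.coeff b r) f hconv hG0 hrz b (fun c hc => ih c hc (hc.trans hb))
        (fun c hc => hrd0 c (hc.trans hb))
      rw [hfd b hb, hrd0 b hb, add_zero] at this
      exact this.symm
  refine ⟨fun b => MvPowerSeries.coeff b G, hG0, hGd, ?_, ?_⟩
  · have := leibnizDefect_conv_of_lt (fun b => MvPowerSeries.coeff b G)
        (fun b => MvPowerSeries.coeff b r) f hconv hG0 hrz a hGd hrd0
    rw [hrd a le_rfl, if_neg hla, add_zero] at this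
    exact this.symm
  · intro b
    induction b using WellFoundedLT.induction with
    | ind b ih =>
      intro hb hb0
      contrapose!
      intro hlb
      have h := hconv b
      -- If `l b ≤ 0`, then `f b = g b + r b`: a further term `g c * r d` has `l d = 0`, hence
      -- `l c = l b ≤ 0`, and `g c = 0` by induction.
      have key : ∀ cd ∈ antidiagonal b, cd ≠ (b, 0) → cd ≠ (0, b) →
          MvPowerSeries.coeff cd.1 G * MvPowerSeries.coeff cd.2 r = 0 := by
        rintro ⟨c, d⟩ hcd hne1 hne2
        rw [HasAntidiagonal.mem_antidiagonal] at hcd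
        simp only at hcd ⊢
        by_cases hld : l d = 0
        · have hc0 : c ≠ 0 := by
            rintro rfl
            exact hne2 (by rw [← hcd, zero_add])
          have hd0 : d ≠ 0 := by
            rintro rfl
            exact hne1 (by rw [← hcd, add_zero])
          have hlt : c < b := hcd ▸ lt_add_of_pos_right c (pos_iff_ne_zero.mpr hd0)
          have hlc : l c = l b := by rw [← hcd, map_add, hld, add_zero]
          have : MvPowerSeries.coeff c G = 0 := by
            by_contra hne
            have := ih c hlt (hlt.le.trans hb) hc0 hne
            omega
          rw [this, zero_mul]
        · rw [hrc, if_neg hld, mul_zero]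
      have hsum : f b = MvPowerSeries.coeff b G + MvPowerSeries.coeff b r := by
        rw [h, ← sum_subset (s₁ := {(b, 0), (0, b)})]
        · rw [sum_pair fun h => hb0 (Prod.ext_iff.mp h).1]
          simp [hrz, hG0]
        · intro x hx
          simp only [mem_insert, mem_singleton] at hx
          rcases hx with rfl | rfl <;> simp
        · intro x hx hx'
          simp only [mem_insert, mem_singleton, not_or] at hx'
          exact key x hx hx'.1 hx'.2
      rw [hrc] at hsum
      split_ifs at hsum with h0
      · simpa using hsum
      · have : f b = 0 := by
          by_contra hne
          have := hf b hb hne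
          omega
        rw [← this, hsum, add_zero]

end Edge

/-! ### Series in two variables and restriction to a ray -/

section Plane

variable {k A : Type*} [CommRing k] [CommRing A] [Algebra k A]

/-- The series `D(u + v)` obtained from `D(t) = ∑ D i t ^ i` by substituting `t = u + v` has the
defects of `D`, multiplied by binomial coefficients. -/
theorem leibnizDefect_add_variables (D : ℕ → Module.End k A) (b : Fin 2 →₀ ℕ) (x y : A) :
    leibnizDefect (fun b : Fin 2 →₀ ℕ => (b 0 + b 1).choose (b 0) • D (b 0 + b 1)) b x y =
      (b 0 + b 1).choose (b 0) • leibnizDefect D (b 0 + b 1) x y := by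
  unfold leibnizDefect
  rw [smul_sub, LinearMap.smul_apply, smul_sum]
  congr 1
  -- Vandermonde's identity, with the terms indexed by pairs of degrees and pairs of first
  -- coordinates.
  have hV : ∀ ij ∈ antidiagonal (b 0 + b 1),
      (b 0 + b 1).choose (b 0) • (D ij.1 x * D ij.2 y) =
      ∑ st ∈ antidiagonal (b 0), (ij.1.choose st.1 * ij.2.choose st.2) •
        (D ij.1 x * D ij.2 y) := by
    intro ij hij
    rw [← sum_smul, ← Nat.add_choose_eq, HasAntidiagonal.mem_antidiagonal.mp hij]
  rw [sum_congr rfl hV, sum_sigma']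
  refine sum_of_injOn
    (fun cd => ⟨(cd.1 0 + cd.1 1, cd.2 0 + cd.2 1), (cd.1 0, cd.2 0)⟩) ?_ ?_ ?_ ?_
  · rintro ⟨c, d⟩ _ ⟨c', d'⟩ _ h
    simp only [Sigma.mk.injEq, Prod.mk.injEq, heq_eq_eq] at h
    obtain ⟨⟨h1, h2⟩, h3, h4⟩ := h
    refine Prod.ext (Finsupp.ext fun i => ?_) (Finsupp.ext fun i => ?_)
    · fin_cases i <;> simp only [Fin.zero_eta, Fin.mk_one] <;> omega
    · fin_cases i <;> simp only [Fin.zero_eta, Fin.mk_one] <;> omega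
  · rintro ⟨c, d⟩ h
    rw [mem_coe, HasAntidiagonal.mem_antidiagonal] at h
    have h : c + d = b := h
    subst h
    simp only [coe_sigma, Set.mem_sigma_iff, mem_coe,
      HasAntidiagonal.mem_antidiagonal, Finsupp.add_apply,
      and_true]
    omega
  · rintro ⟨⟨i, j⟩, ⟨s, t⟩⟩ h hn
    simp only [mem_sigma, HasAntidiagonal.mem_antidiagonal] at h hn ⊢
    obtain ⟨h1, h2⟩ := h
    by_cases hs : s ≤ i
    · by_cases ht : t ≤ j
      · refine absurd ⟨(Finsupp.single 0 s + Finsupp.single 1 (i - s),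
          Finsupp.single 0 t + Finsupp.single 1 (j - t)), ?_, ?_⟩ hn
        · rw [mem_coe, HasAntidiagonal.mem_antidiagonal]
          refine Finsupp.ext fun i => ?_
          fin_cases i <;> simp <;> omega
        · simp [hs, ht]
      · rw [Nat.choose_eq_zero_of_lt (not_le.mp ht), mul_zero, zero_smul]
    · rw [Nat.choose_eq_zero_of_lt (not_le.mp hs), zero_mul, zero_smul]
  · rintro ⟨c, d⟩ _
    simp only [LinearMap.smul_apply, smul_mul_smul_comm]

/-- If the support of `f` lies in the cone `r * b 0 ≤ b 1`, then the restriction of `f` to the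
boundary ray spanned by `(1, r)` is a series in one variable with the same defects. -/
theorem leibnizDefect_ray (r j : ℕ) (f : (Fin 2 →₀ ℕ) → Module.End k A)
    (hf : ∀ b ≤ Finsupp.single 0 j + Finsupp.single 1 (r * j), f b ≠ 0 → r * b 0 ≤ b 1) :
    leibnizDefect (fun i => f (Finsupp.single 0 i + Finsupp.single 1 (r * i))) j =
      leibnizDefect f (Finsupp.single 0 j + Finsupp.single 1 (r * j)) := by
  funext x y
  unfold leibnizDefect
  congr 1
  refine sum_of_injOn (fun st => (Finsupp.single 0 st.1 + Finsupp.single 1 (r * st.1),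
    Finsupp.single 0 st.2 + Finsupp.single 1 (r * st.2))) ?_ ?_ ?_ ?_
  · rintro ⟨c, d⟩ _ ⟨c', d'⟩ _ h
    simp only [Prod.mk.injEq] at h
    have h1 := DFunLike.congr_fun h.1 0
    have h2 := DFunLike.congr_fun h.2 0
    simp at h1 h2
    simp [h1, h2]
  · rintro ⟨c, d⟩ h
    rw [mem_coe, HasAntidiagonal.mem_antidiagonal] at h
    have h : c + d = j := h
    subst h
    rw [mem_coe, HasAntidiagonal.mem_antidiagonal]
    refine Finsupp.ext fun i => ?_
    fin_cases i <;> simp [mul_add]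
  · rintro ⟨b, c⟩ h hn
    rw [HasAntidiagonal.mem_antidiagonal] at h
    simp only at h ⊢
    have h0 := DFunLike.congr_fun h 0
    have h1 := DFunLike.congr_fun h 1
    simp at h0 h1
    by_contra hne
    have hb : f b ≠ 0 := fun h => hne (by simp [h])
    have hc : f c ≠ 0 := fun h => hne (by simp [h])
    have hb' := hf b (h ▸ le_self_add) hb
    have hc' := hf c (h ▸ le_add_self) hc
    have hm : r * b 0 + r * c 0 = b 1 + c 1 := by rw [← mul_add, h0, h1]
    refine hn ⟨(b 0, c 0), ?_, Prod.ext (Finsupp.ext fun i => ?_) (Finsupp.ext fun i => ?_)⟩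
    · rw [mem_coe, HasAntidiagonal.mem_antidiagonal, h0]
    · fin_cases i
      · simp
      · simp; omega
    · fin_cases i
      · simp
      · simp; omega
  · intros; rfl

/-- The support of `f` can be moved into the cone `r * b 0 ≤ b 1` without changing the defect at the
point `(m, r * m)` of its boundary ray: the edges of smaller slope are removed one after the other. -/
theorem exists_cone_support (m r : ℕ) (f : (Fin 2 →₀ ℕ) → Module.End k A) (hf0 : f 0 = 1)
    (a : Fin 2 →₀ ℕ) (ha : a = Finsupp.single 0 m + Finsupp.single 1 (r * m)) (hm : 0 < m)
    (hfd : ∀ b < a, leibnizDefect f b = 0) :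
    ∃ g : (Fin 2 →₀ ℕ) → Module.End k A, g 0 = 1 ∧ (∀ b < a, leibnizDefect g b = 0) ∧
      leibnizDefect g a = leibnizDefect f a ∧ ∀ b ≤ a, g b ≠ 0 → r * b 0 ≤ b 1 := by
  have ha0 : a 0 = m := by simp [ha]
  have ha1 : a 1 = r * m := by simp [ha]
  -- The points considered have `b 0 ≤ m`, so their slopes `b 1 / b 0` are multiples of `1 / m!`, and
  -- the slopes below `r` are exhausted by the values `c / m!`.
  have step : ∀ c ≤ m.factorial * r, ∃ g : (Fin 2 →₀ ℕ) → Module.End k A, g 0 = 1 ∧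
      (∀ b < a, leibnizDefect g b = 0) ∧ leibnizDefect g a = leibnizDefect f a ∧
      ∀ b ≤ a, g b ≠ 0 → c * b 0 ≤ m.factorial * b 1 := by
    intro c
    induction c with
    | zero => exact fun _ => ⟨f, hf0, hfd, rfl, by simp⟩
    | succ c ih =>
      intro hc
      obtain ⟨g, hg0, hgd, hga, hg⟩ := ih (by omega)
      let l : (Fin 2 →₀ ℕ) →+ ℤ :=
        { toFun := fun b => (m.factorial : ℤ) * b 1 - c * b 0
          map_zero' := by simp
          map_add' := fun b d => by simp only [Finsupp.add_apply]; push_cast; ring }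
      have hl : ∀ b, l b = (m.factorial : ℤ) * b 1 - c * b 0 := fun _ => rfl
      obtain ⟨h, hh0, hhd, hha, hh⟩ := exists_remove_edge l g hg0 a hgd
        (fun b hb hne => by
          have := hg b hb hne
          rw [hl, sub_nonneg]
          exact_mod_cast this)
        (by
          rw [hl, ha0, ha1, sub_ne_zero]
          have : c * m < m.factorial * (r * m) := by
            rw [← mul_assoc]
            exact Nat.mul_lt_mul_of_pos_right (by omega) hm
          exact_mod_cast this.ne')
      refine ⟨h, hh0, hhd, hha.trans hga, fun b hb hne => ?_⟩
      rcases Nat.eq_zero_or_pos (b 0) with hb0 | hb0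
      · simp [hb0]
      have hlt := hh b hb (by rintro rfl; simp at hb0) hne
      rw [hl, sub_pos] at hlt
      have hlt : c * b 0 < m.factorial * b 1 := by exact_mod_cast hlt
      obtain ⟨t, ht⟩ := Nat.dvd_factorial hb0 (ha0 ▸ hb 0 : b 0 ≤ m)
      rw [ht, mul_comm, mul_assoc] at hlt ⊢
      exact Nat.mul_le_mul_left _ (lt_of_mul_lt_mul_left hlt (Nat.zero_le _))
  obtain ⟨g, hg0, hgd, hga, hg⟩ := step _ le_rfl
  refine ⟨g, hg0, hgd, hga, fun b hb hne => ?_⟩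
  have := hg b hb hne
  rw [mul_assoc] at this
  exact le_of_mul_le_mul_left this m.factorial_pos

/-- From a series `D` with first defect in degree `m + r * m`, a series with first defect in the
smaller degree `m`, equal to that of `D` up to the binomial coefficient. -/
theorem exists_leibnizDefect_eq_choose_smul (D : ℕ → Module.End k A) (hD0 : D 0 = 1) (m r : ℕ)
    (hm : 0 < m) (hD : ∀ i < m + r * m, leibnizDefect D i = 0) :
    ∃ G : ℕ → Module.End k A, G 0 = 1 ∧ (∀ i < m, leibnizDefect G i = 0) ∧
      leibnizDefect G m = (m + r * m).choose m • leibnizDefect D (m + r * m) := by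
  have hE := leibnizDefect_add_variables D
  set a : Fin 2 →₀ ℕ := Finsupp.single 0 m + Finsupp.single 1 (r * m) with ha
  have ha0 : a 0 = m := by simp [ha]
  have ha1 : a 1 = r * m := by simp [ha]
  obtain ⟨g, hg0, hgd, hga, hg⟩ := exists_cone_support m r
    (fun b : Fin 2 →₀ ℕ => (b 0 + b 1).choose (b 0) • D (b 0 + b 1)) (by simp [hD0]) a ha hm
    (fun b hb => by
      funext x y
      have h0 : b 0 ≤ a 0 := hb.le 0
      have h1 : b 1 ≤ a 1 := hb.le 1
      have hlt : b 0 + b 1 < m + r * m := by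
        by_contra hge
        refine hb.ne (Finsupp.ext fun i => ?_)
        fin_cases i <;> simp only [Fin.zero_eta, Fin.mk_one] <;> omega
      rw [hE, hD _ hlt]
      simp)
  have hle : ∀ j ≤ m, Finsupp.single 0 j + Finsupp.single 1 (r * j) ≤ a := by
    intro j hj i
    fin_cases i
    · simpa [ha] using hj
    · simpa [ha] using Nat.mul_le_mul_left r hj
  refine ⟨fun i => g (Finsupp.single 0 i + Finsupp.single 1 (r * i)), by simp [hg0], ?_, ?_⟩
  · intro j hj
    rw [leibnizDefect_ray r j g fun b hb => hg b (hb.trans (hle j hj.le))]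
    refine hgd _ (lt_of_le_of_ne (hle j hj.le) fun h => ?_)
    have := DFunLike.congr_fun h 0
    simp [ha] at this
    omega
  · rw [leibnizDefect_ray r m g fun b hb => hg b (hb.trans (hle m le_rfl)), ← ha, hga]
    funext x y
    rw [hE, ha0, ha1]
    rfl

end Plane

/-! ### Series in one variable -/

section Line

variable {k A : Type*} [CommRing k] [CommRing A] [Algebra k A]

/-- The `c`-th power of `G` has first defect `c` times that of `G`. -/
theorem exists_leibnizDefect_eq_smul (G : ℕ → Module.End k A) (hG0 : G 0 = 1) (m : ℕ)
    (hG : ∀ i < m, leibnizDefect G i = 0) (c : ℕ) :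
    ∃ H : ℕ → Module.End k A, H 0 = 1 ∧ (∀ i < m, leibnizDefect H i = 0) ∧
      leibnizDefect H m = c • leibnizDefect G m := by
  induction c with
  | zero =>
    have h : ∀ i, leibnizDefect (HasseSchmidt.one (k := k) (A := A) (m := ⊤)).comp i = 0 :=
      fun i => by
        funext x y
        exact sub_eq_zero.mpr (HasseSchmidt.one.leibniz i le_top x y)
    exact ⟨_, HasseSchmidt.comp_zero _, fun i _ => h i, by rw [h, zero_smul]⟩
  | succ c ih =>
    obtain ⟨H, hH0, hH, hHm⟩ := ih
    have key : ∀ j ≤ m, leibnizDefect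
        (fun i => ∑ bc ∈ antidiagonal i, H bc.1 * G bc.2) j =
        leibnizDefect H j + leibnizDefect G j := fun j hj =>
      leibnizDefect_conv_of_lt H G _ (fun _ => rfl) hH0 hG0 j
        (fun b hb => hH b (hb.trans_le hj)) (fun b hb => hG b (hb.trans_le hj))
    refine ⟨fun i => ∑ bc ∈ antidiagonal i, H bc.1 * G bc.2, by simp [hH0, hG0], ?_, ?_⟩
    · intro j hj
      rw [key j hj.le, hH j hj, hG j hj, add_zero]
    · rw [key m le_rfl, hHm, succ_nsmul]

/-- The defects of `H(t ^ q)`. -/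
theorem leibnizDefect_dilate (q : ℕ) (hq : 0 < q) (H : ℕ → Module.End k A) (j : ℕ) :
    leibnizDefect (fun i => if q ∣ i then H (i / q) else 0) j =
      if q ∣ j then leibnizDefect H (j / q) else 0 := by
  funext x y
  split_ifs with hj
  · obtain ⟨i, rfl⟩ := hj
    unfold leibnizDefect
    simp only [dvd_mul_right, if_true, Nat.mul_div_cancel_left _ hq]
    congr 1
    symm
    refine sum_of_injOn (fun st => (q * st.1, q * st.2)) ?_ ?_ ?_ ?_
    · rintro ⟨c, d⟩ _ ⟨c', d'⟩ _ h
      simpa [hq.ne'] using h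
    · rintro ⟨c, d⟩ h
      simp only [mem_coe, HasAntidiagonal.mem_antidiagonal] at h ⊢
      rw [← mul_add, h]
    · rintro ⟨b, c⟩ h hn
      simp only [HasAntidiagonal.mem_antidiagonal] at h hn ⊢
      by_cases hb : q ∣ b
      · have hc : q ∣ c := (Nat.dvd_add_right hb).mp (h ▸ dvd_mul_right q i)
        obtain ⟨b, rfl⟩ := hb
        obtain ⟨c, rfl⟩ := hc
        refine absurd ⟨(b, c), ?_, rfl⟩ hn
        rw [mem_coe, HasAntidiagonal.mem_antidiagonal]
        rw [← mul_add] at h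
        exact Nat.eq_of_mul_eq_mul_left hq h
      · simp [hb]
    · rintro ⟨c, d⟩ _
      simp [Nat.mul_div_cancel_left _ hq]
  · unfold leibnizDefect
    simp only [if_neg hj]
    rw [sum_eq_zero]
    · simp
    rintro ⟨b, c⟩ h
    rw [HasAntidiagonal.mem_antidiagonal] at h
    simp only at h ⊢
    by_cases hb : q ∣ b
    · have hc : ¬ q ∣ c := fun hc => hj (h ▸ dvd_add hb hc)
      simp [hc]
    · simp [hb]

end Line

/-! ### Integrable derivations -/

theorem IDer_anti (k : Type u) (A : Type v) [CommRing k] [CommRing A] [Algebra k A] {m n : ℕ}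
    (hm : 1 ≤ m) (hmn : m ≤ n) : IDer k A (n : ℕ∞) ≤ IDer k A (m : ℕ∞) := by
  rintro δ ⟨D, hD⟩
  refine ⟨⟨fun i => if i ≤ m then D.comp i else 0, by simp [D.comp_zero], ?_, ?_⟩, ?_⟩
  · intro i hi x y
    have hi : i ≤ m := by exact_mod_cast hi
    rw [if_pos hi, D.leibniz i (by exact_mod_cast hi.trans hmn)]
    refine sum_congr rfl fun bc hbc => ?_
    rw [HasAntidiagonal.mem_antidiagonal] at hbc
    rw [if_pos (by omega), if_pos (by omega)]
  · intro i hi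
    exact if_neg (not_le.mpr (by exact_mod_cast hi))
  · simp only [if_pos hm, hD]

/-- For `n = p ^ s * q` with `1 < q` prime to `p`, a Hasse–Schmidt derivation `D` of length `n - 1` is
multiplied by a series in `t ^ q` whose defect in degree `n` is the opposite of that of `D`. Since
`1 < q`, the component of index `1` does not change. -/
theorem IDer_pred_le (p : ℕ) (hp : p.Prime) (k : Type u) (A : Type v) [CommRing k] [CharP k p]
    [CommRing A] [Algebra k A] (n : ℕ) (hn : 1 < n) (hnp : ¬ ∃ j : ℕ, n = p ^ j) :
    IDer k A ((n - 1 : ℕ) : ℕ∞) ≤ IDer k A (n : ℕ∞) := by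
  rintro δ ⟨D, hD⟩
  have : Fact p.Prime := ⟨hp⟩
  obtain ⟨s, q, hpq, hnq⟩ := Nat.exists_eq_pow_mul_and_not_dvd (by omega : n ≠ 0) p hp.ne_one
  have hq2 : 2 ≤ q := by
    by_contra hq
    interval_cases q
    · simp at hpq
    · exact hnp ⟨s, by simpa using hnq⟩
  set m := p ^ s with hm
  have hm0 : 0 < m := pow_pos hp.pos s
  have hmn : m + (q - 1) * m = n := by
    obtain ⟨r, rfl⟩ : ∃ r, q = r + 1 := ⟨q - 1, by omega⟩
    rw [hnq, Nat.add_sub_cancel]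
    ring
  have hDd : ∀ i < n, leibnizDefect D.comp i = 0 := fun i hi => by
    funext x y
    exact sub_eq_zero.mpr (D.leibniz i (by exact_mod_cast (by omega : i ≤ n - 1)) x y)
  obtain ⟨G, hG0, hGd, hGm⟩ := exists_leibnizDefect_eq_choose_smul D.comp D.comp_zero m (q - 1) hm0
    (hmn ▸ hDd)
  rw [hmn] at hGm
  -- Lucas: `(p ^ s * q).choose (p ^ s) ≡ q.choose 1`.
  have hB : n.choose m ≡ q [MOD p] := by
    have := Choose.choose_pow_mul_pow_mul_modEq_choose_nat (p := p) (a := q) (b := 1) (k := s)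
    simpa [← hm, ← hnq] using this
  obtain ⟨c, hc⟩ : ∃ c : ℕ, p ∣ c * n.choose m + 1 := by
    have hB0 : (n.choose m : ZMod p) ≠ 0 := by
      rw [(ZMod.natCast_eq_natCast_iff _ _ _).mpr hB, Ne, ZMod.natCast_eq_zero_iff]
      exact hpq
    refine ⟨(-(n.choose m : ZMod p)⁻¹).val, ?_⟩
    rw [← ZMod.natCast_eq_zero_iff]
    simp [hB0]
  obtain ⟨H, hH0, hHd, hHm⟩ := exists_leibnizDefect_eq_smul G hG0 m hGd c
  let K : ℕ → Module.End k A := fun i => if q ∣ i then H (i / q) else 0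
  have hK0 : K 0 = 1 := by simp [K, hH0]
  have hKd : ∀ i < n, leibnizDefect K i = 0 := fun i hi => by
    rw [leibnizDefect_dilate q (by omega)]
    split_ifs with h
    · exact hHd _ (Nat.div_lt_of_lt_mul (by rwa [mul_comm, ← hnq]))
    · rfl
  have hKn : leibnizDefect K n = leibnizDefect H m := by
    rw [leibnizDefect_dilate q (by omega), if_pos (hnq ▸ dvd_mul_left q m), hnq,
      Nat.mul_div_cancel _ (by omega)]
  let F : ℕ → Module.End k A := fun i => ∑ bc ∈ antidiagonal i, D.comp bc.1 * K bc.2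
  have hFd : ∀ i ≤ n, leibnizDefect F i = 0 := fun i hi => by
    have hF := leibnizDefect_conv_of_lt D.comp K F (fun _ => rfl) D.comp_zero hK0 i
      (fun b hb => hDd b (hb.trans_le hi)) (fun b hb => hKd b (hb.trans_le hi))
    rw [hF]
    rcases hi.lt_or_eq with hlt | rfl
    · rw [hDd i hlt, hKd i hlt, add_zero]
    -- The total defect in degree `n` is `(1 + c * n.choose m)` times that of `D`, a multiple of `p`.
    · obtain ⟨t, ht⟩ := hc
      have hpk : (p : k) = 0 := CharP.cast_eq_zero k p
      rw [hKn, hHm, hGm, smul_smul, add_comm, ← succ_nsmul, ht]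
      funext x y
      simp only [Pi.smul_apply, Pi.zero_apply]
      rw [mul_comm, mul_smul, ← Nat.cast_smul_eq_nsmul k p, hpk]
      simp
  refine ⟨⟨fun i => if i ≤ n then F i else 0, ?_, ?_, ?_⟩, ?_⟩
  · simp [F, hK0, D.comp_zero]
  · intro i hi x y
    have hi : i ≤ n := by exact_mod_cast hi
    rw [if_pos hi, sub_eq_zero.mp (congrFun (congrFun (hFd i hi) x) y)]
    refine sum_congr rfl fun bc hbc => ?_
    rw [HasAntidiagonal.mem_antidiagonal] at hbc
    rw [if_pos (by omega), if_pos (by omega)]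
  · intro i hi
    exact if_neg (not_le.mpr (by exact_mod_cast hi))
  · have hK1 : K 1 = 0 := if_neg fun h => by have := Nat.le_of_dvd one_pos h; omega
    simp only [if_pos hn.le, F, Nat.antidiagonal_succ]
    simp [hK0, hK1, hD, D.comp_zero]

theorem theorem4p1 (p : ℕ) (hp : p.Prime) (k : Type u) (A : Type v) [CommRing k] [CharP k p]
    [CommRing A] [Algebra k A] :
    (∀ n : ℕ, 1 < n → (¬ ∃ j : ℕ, n = p ^ j) →
      IDer k A ((n - 1 : ℕ) : ℕ∞) = IDer k A (n : ℕ∞)) ∧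
    (∀ s : ℕ, HasLeap k A s → ∃ j : ℕ, s = p ^ j) := by
  refine ⟨fun n hn hnp => le_antisymm (IDer_pred_le p hp k A n hn hnp)
    (IDer_anti k A (by omega) (by omega)), ?_⟩
  rintro s ⟨hs, hlt⟩
  by_contra hsp
  exact hlt.not_ge (IDer_pred_le p hp k A s hs hsp)
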